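/- Fix $0\le\theta<1$. For each $n$ let $X=(X_1,\dots,X_n)\in\{\pm1\}^n$ follow the Curie–Weiss model $$P_{\theta,\mu}(X=x)=\frac1{Z(\theta,\mu)}\exp\Big(\frac{\theta}{n}\sum_{1\le i<j\le n}x_ix_j+\sum_{i=1}^n\mu_ix_i\Big),\qquad x\in\{\pm1\}^n,\ \mu\in\mathbb R^n,$$ where $Z(\theta,\mu)$ is the normalizing constant, and let $\bar X=\frac1n\sum_{i=1}^nX_i$. Let $s=s_n\in\{0,1,\dots,n\}$ and $B=B_n>0$ be arbitrary sequences, and let $\Xi(s,B)$ be the set of $\mu\in\mathbb R^n$ that have exactly $s$ nonzero coordinates, each of them at least $B$. Consider testing $H_0:\mu=0$ against $H_1:\mu\in\Xi(s,B)$. A test is a function $T:\{\pm1\}^n\to\{0,1\}$ (with $1$ meaning rejection of $H_0$), and its worst case risk is $$\mathrm{Risk}(T)=P_{\theta,0}(T(X)=1)+\sup_{\mu\in\Xi(s,B)}P_{\theta,\mu}(T(X)=0).$$ A sequence of tests $T=T_n$ is called asymptotically powerful if $\limsup_{n\to\infty}\mathrm{Risk}(T_n)=0$, and asymptotically not powerful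 if $\liminf_{n\to\infty}\mathrm{Risk}(T_n)>0$. (i) If $\sqrt n=o(s\tanh B)$, then for every sequence $L_n\to\infty$ with $L_n=o(n^{-1/2}s\tanh B)$, the test that rejects $H_0$ if and only if $\sqrt n\,\bar X\ge L_n$ is asymptotically powerful. (ii) Conversely, if $s\tanh B=O(\sqrt n)$, then there is no asymptotically powerful sequence of tests; indeed every sequence of tests is asymptotically not powerful. -/

import Mathlib

open Filter Asymptotics

noncomputable section

namespace CurieWeiss

/-- The configuration space `{±1}^n`; `ℤˣ` is exactly the set `{1, -1}`. -/
abbrev Config (n : ℕ) : Type := Fin n → ℤˣ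

/-- The value of a spin as a real number, `1` or `-1`. -/
def spin (e : ℤˣ) : ℝ := ((e : ℤ) : ℝ)

/-- The unnormalised Curie–Weiss density
`exp ((θ / n) ∑_{i < j} x_i x_j + ∑_i μ_i x_i)`. -/
def weight (θ : ℝ) {n : ℕ} (μ : Fin n → ℝ) (x : Config n) : ℝ :=
  Real.exp (θ / n * ∑ i : Fin n, ∑ j ∈ Finset.Ioi i, spin (x i) * spin (x j)
    + ∑ i : Fin n, μ i * spin (x i))

/-- The normalising constant `Z(θ, μ)`. -/
def partitionFn (θ : ℝ) {n : ℕ} (μ : Fin n → ℝ) : ℝ :=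
  ∑ x : Config n, weight θ μ x

open Classical in
/-- The probability `P_{θ, μ}(X ∈ A)` of an event under the Curie–Weiss model. -/
def prob (θ : ℝ) {n : ℕ} (μ : Fin n → ℝ) (A : Set (Config n)) : ℝ :=
  ∑ x : Config n with x ∈ A, weight θ μ x / partitionFn θ μ

/-- The alternative `Ξ(s, B)`: exactly `s` nonzero coordinates, each of them at least `B`. -/
def alternatives (n s : ℕ) (B : ℝ) : Set (Fin n → ℝ) :=
  {μ | (Function.support μ).ncard = s ∧ ∀ i ∈ Function.support μ, B ≤ μ i}

/-- A test: a `{0, 1}`-valued function of the data, `1` meaning that `H₀` is rejected.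
Every function on the finite set `{±1}^n` is measurable. -/
abbrev Test (n : ℕ) : Type := Config n → Fin 2

/-- The worst case risk: the probability of a false rejection under `μ = 0`, plus the supremum
over `Ξ(s, B)` of the probability of a false acceptance. -/
def risk (θ : ℝ) {n : ℕ} (T : Test n) (s : ℕ) (B : ℝ) : ℝ :=
  prob θ (0 : Fin n → ℝ) {x | T x = 1}
    + ⨆ μ : alternatives n s B, prob θ (μ : Fin n → ℝ) {x | T x = 0}

/-- The sequence of tests `T` is asymptotically powerful against `Ξ(s_n, B_n)`. -/
def AsymptoticallyPowerful (θ : ℝ) (s : ℕ → ℕ) (B : ℕ → ℝ) (T : ∀ n, Test n) : Prop :=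
  limsup (fun n => risk θ (T n) (s n) (B n)) atTop = 0

/-- The sequence of tests `T` is asymptotically not powerful against `Ξ(s_n, B_n)`. -/
def AsymptoticallyNotPowerful (θ : ℝ) (s : ℕ → ℕ) (B : ℕ → ℝ) (T : ∀ n, Test n) : Prop :=
  0 < liminf (fun n => risk θ (T n) (s n) (B n)) atTop

/-- The sample mean `X̄`. -/
def sampleMean {n : ℕ} (x : Config n) : ℝ := (∑ i : Fin n, spin (x i)) / n

open Classical in
/-- The naive test, which rejects if and only if `√n X̄ ≥ L`. -/
def naiveTest (n : ℕ) (L : ℝ) : Test n :=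
  fun x => if L ≤ √(n : ℝ) * sampleMean x then 1 else 0

end CurieWeiss

end

namespace CurieWeiss

open MeasureTheory ProbabilityTheory

/-! Let `M` be the sum of the spins. Up to constants, the model is the product law with means `tanh
μ_i`, reweighted by `exp (θ M² / (2n))`. Writing this weight as a Gaussian average of exponentials
linear in `M` restores independence; Hoeffding's lemma then gives bounds uniform in `n`, finite
because `θ < 1` (`sum_productMass_mul_exp_sq_le`).

For (i), `M / √n` has Gaussian tails under the null, while under an alternative it is pushed up by
`∑ tanh μ_i / √n ≥ s tanh B / √n`, which dominates `L`. Two Chernoff bounds suffice.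

For (ii), mix alternatives by choosing one active site in each of `s` disjoint blocks of size
`⌊n/s⌋`. Cauchy–Schwarz on the rejection region reduces the problem to pairwise overlaps, whose sum
factorises over blocks and stays bounded when `s tanh B = O(√n)`. Hence `(1 - σ)² ≤ M₀ ε` for the
two errors `ε`, `σ` of any test (`one_sub_iSup_sq_le`), so they cannot both vanish. -/

lemma sum_units (f : ℤˣ → ℝ) : ∑ e, f e = f 1 + f (-1) := by
  rw [UnitsInt.univ, Finset.sum_pair (by decide)]

@[simp] lemma spin_one : spin 1 = 1 := by simp [spin]

@[simp] lemma spin_neg_one : spin (-1) = -1 := by simp [spin]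

lemma spin_cases (e : ℤˣ) : spin e = 1 ∨ spin e = -1 := by
  rcases Int.units_eq_one_or e with rfl | rfl <;> simp

lemma spin_mul_self (e : ℤˣ) : spin e * spin e = 1 := by
  rcases spin_cases e with h | h <;> rw [h] <;> norm_num

/-! ### Exponential moments of one spin and of a Gaussian -/

/-- Hoeffding's lemma for a spin of mean `b`. -/
lemma two_point_mgf_le {b : ℝ} (hb : |b| ≤ 1) (z : ℝ) :
    (1 + b) / 2 * Real.exp z + (1 - b) / 2 * Real.exp (-z) ≤ Real.exp (z ^ 2 / 2 + z * b) := by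
  obtain ⟨hb1, hb2⟩ := abs_le.1 hb
  set ν : Measure ℝ := ENNReal.ofReal ((1 + b) / 2) • Measure.dirac 1
    + ENNReal.ofReal ((1 - b) / 2) • Measure.dirac (-1) with hν
  have hint : ∀ f : ℝ → ℝ, ∫ x, f x ∂ν = (1 + b) / 2 * f 1 + (1 - b) / 2 * f (-1) := by
    intro f
    rw [hν, integral_add_measure, integral_smul_measure, integral_smul_measure, integral_dirac,
      integral_dirac, ENNReal.toReal_ofReal (by linarith), ENNReal.toReal_ofReal (by linarith)]
    · simp
    · exact (integrable_dirac (by simp)).smul_measure (by simp)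
    · exact (integrable_dirac (by simp)).smul_measure (by simp)
  have hprob : IsProbabilityMeasure ν := ⟨by
    rw [hν]
    simp only [Measure.coe_add, Measure.coe_smul, Pi.add_apply, Pi.smul_apply, measure_univ,
      smul_eq_mul, mul_one]
    rw [← ENNReal.ofReal_add (by linarith) (by linarith), ← ENNReal.ofReal_one]
    congr 1; ring⟩
  have hmem : ∀ᵐ ω ∂ν, (id ω : ℝ) ∈ Set.Icc (-1 : ℝ) 1 := by
    rw [hν, ae_add_measure_iff]
    constructor <;> refine Measure.ae_smul_measure ?_ _ <;> rw [ae_dirac_eq] <;> simp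
  have h := (hasSubgaussianMGF_of_mem_Icc (μ := ν) (X := id) aemeasurable_id hmem).mgf_le z
  rw [mgf, hint, hint] at h
  -- The variance proxy is the squared half-length of `[-1, 1]`.
  have e1 : (((‖(1 : ℝ) - -1‖₊ / 2) ^ 2 : NNReal) : ℝ) = 1 := by
    push_cast
    norm_num
  rw [e1] at h
  simp only [id] at h
  calc (1 + b) / 2 * Real.exp z + (1 - b) / 2 * Real.exp (-z)
      = Real.exp (z * b) * ((1 + b) / 2 * Real.exp (z * (1 - ((1 + b) / 2 * 1 + (1 - b) / 2 * -1)))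
        + (1 - b) / 2 * Real.exp (z * (-1 - ((1 + b) / 2 * 1 + (1 - b) / 2 * -1)))) := by
        rw [mul_add, mul_left_comm, ← Real.exp_add, mul_left_comm (Real.exp (z * b)),
          ← Real.exp_add]
        congr 3 <;> ring_nf
    _ ≤ Real.exp (z * b) * Real.exp (1 * z ^ 2 / 2) :=
        mul_le_mul_of_nonneg_left h (Real.exp_pos _).le
    _ = _ := by rw [← Real.exp_add]; congr 1; ring

/-- Against the Gaussian density the integrand decays like `exp (-(1 - κ) g² / 2)`. This is where
subcriticality is used. -/
lemma integrable_exp_mul_sq_gaussianReal {κ : ℝ} (hκ : κ < 1) :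
    Integrable (fun g => Real.exp (κ * g ^ 2 / 2)) (gaussianReal 0 1) := by
  rw [gaussianReal_of_var_ne_zero _ one_ne_zero,
    integrable_withDensity_iff_integrable_smul' (measurable_gaussianPDF 0 1)
      (ae_of_all _ fun _ => by simp [gaussianPDF])]
  have h := (integrable_exp_neg_mul_sq (b := (1 - κ) / 2) (by linarith)).const_mul
    (√(2 * Real.pi * ((1 : NNReal) : ℝ)))⁻¹
  refine h.congr (ae_of_all _ fun g => ?_)
  simp only [gaussianPDF, smul_eq_mul, ENNReal.toReal_ofReal (gaussianPDFReal_nonneg 0 1 g)]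
  rw [gaussianPDFReal, mul_assoc _ (Real.exp _) (Real.exp _), ← Real.exp_add]
  congr 2
  push_cast
  ring

/-- The exponential moment `E exp (κ G² / 2)` of a standard Gaussian `G`. -/
noncomputable def gaussianSqMGF (κ : ℝ) : ℝ := ∫ g, Real.exp (κ * g ^ 2 / 2) ∂(gaussianReal 0 1)

lemma gaussianSqMGF_pos {κ : ℝ} (hκ : κ < 1) : 0 < gaussianSqMGF κ :=
  integral_exp_pos (integrable_exp_mul_sq_gaussianReal hκ)

/-- The linearisation of `exp (a² / 2)` by a standard Gaussian. -/
lemma integral_exp_mul_gaussianReal (a : ℝ) :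
    ∫ g, Real.exp (a * g) ∂(gaussianReal 0 1) = Real.exp (a ^ 2 / 2) := by
  have h := mgf_gaussianReal (p := gaussianReal 0 1) (X := id) (μ := 0) (v := 1) (by simp) a
  simpa [mgf] using h

/-! ### Product laws and quadratic exponential moments -/

/-- The sum of the spins. -/
noncomputable def magnetization {n : ℕ} (x : Config n) : ℝ := ∑ i, spin (x i)

/-- The mass function of independent spins with means `b i`. -/
noncomputable def productMass {n : ℕ} (b : Fin n → ℝ) (x : Config n) : ℝ :=
  ∏ i, (1 + b i * spin (x i)) / 2

lemma productMass_nonneg {n : ℕ} {b : Fin n → ℝ} (hb : ∀ i, |b i| ≤ 1) (x : Config n) :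
    0 ≤ productMass b x := by
  refine Finset.prod_nonneg fun i _ => ?_
  obtain ⟨h1, h2⟩ := abs_le.1 (hb i)
  rcases spin_cases (x i) with h | h <;> rw [h] <;> linarith

lemma sum_productMass {n : ℕ} (b : Fin n → ℝ) : ∑ x, productMass b x = 1 := by
  simp only [productMass]
  rw [← Fintype.prod_sum fun i e => (1 + b i * spin e) / 2]
  refine Finset.prod_eq_one fun i _ => ?_
  rw [sum_units]
  simp
  ring

lemma sum_productMass_mul_exp_le {n : ℕ} {b : Fin n → ℝ} (hb : ∀ i, |b i| ≤ 1) (z : ℝ) :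
    ∑ x, productMass b x * Real.exp (z * magnetization x)
      ≤ Real.exp (n * (z ^ 2 / 2) + z * ∑ i, b i) := by
  calc ∑ x, productMass b x * Real.exp (z * magnetization x)
      = ∑ x : Config n, ∏ i, (1 + b i * spin (x i)) / 2 * Real.exp (z * spin (x i)) := by
        refine Finset.sum_congr rfl fun x _ => ?_
        rw [Finset.prod_mul_distrib, ← Real.exp_sum, ← Finset.mul_sum]
        rfl
    _ = ∏ i, ∑ e, (1 + b i * spin e) / 2 * Real.exp (z * spin e) :=
        (Fintype.prod_sum fun i e => (1 + b i * spin e) / 2 * Real.exp (z * spin e)).symm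
    _ ≤ ∏ i, Real.exp (z ^ 2 / 2 + z * b i) := by
        refine Finset.prod_le_prod (fun i _ => ?_) fun i _ => ?_
        · obtain ⟨h1, h2⟩ := abs_le.1 (hb i)
          refine Finset.sum_nonneg fun e _ => mul_nonneg ?_ (Real.exp_pos _).le
          rcases spin_cases e with h | h <;> rw [h] <;> linarith
        · rw [sum_units]
          simpa [← sub_eq_add_neg] using two_point_mgf_le (hb i) z
    _ = _ := by
        rw [← Real.exp_sum, Finset.sum_add_distrib, ← Finset.mul_sum]
        simp

/-- The Hubbard–Stratonovich bound, with the mean `m` of the magnetization tilted away. -/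
lemma sum_productMass_mul_exp_sq_le {n : ℕ} (hn : 0 < n) {θ : ℝ} (hθ0 : 0 ≤ θ) (hθ1 : θ < 1)
    {b : Fin n → ℝ} (hb : ∀ i, |b i| ≤ 1) {m : ℝ} (hm : ∑ i, b i = m) :
    ∑ x, productMass b x *
        Real.exp (θ * magnetization x ^ 2 / (2 * n) - m / n * magnetization x)
      ≤ gaussianSqMGF θ * Real.exp (-(m ^ 2 / (2 * n))) := by
  have hn' : (0 : ℝ) < n := by exact_mod_cast hn
  have hsq : √(θ / n) ^ 2 = θ / n := Real.sq_sqrt (by positivity)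
  have hlin : ∀ x : Config n,
      Real.exp (θ * magnetization x ^ 2 / (2 * n) - m / n * magnetization x)
        = ∫ g, Real.exp ((√(θ / n) * g - m / n) * magnetization x) ∂(gaussianReal 0 1) := by
    intro x
    have h1 : ∀ g : ℝ, Real.exp ((√(θ / n) * g - m / n) * magnetization x)
        = Real.exp (-(m / n * magnetization x))
          * Real.exp (√(θ / n) * magnetization x * g) := by
      intro g
      rw [← Real.exp_add]
      congr 1
      ring
    simp_rw [h1]
    rw [integral_const_mul, integral_exp_mul_gaussianReal, ← Real.exp_add]
    congr 1
    rw [mul_pow, hsq]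
    field_simp
    ring
  have hint : ∀ x : Config n, Integrable (fun g => productMass b x *
      Real.exp ((√(θ / n) * g - m / n) * magnetization x)) (gaussianReal 0 1) := by
    intro x
    have h := (integrable_exp_mul_gaussianReal (μ := 0) (v := 1)
      (√(θ / n) * magnetization x)).const_mul
        (productMass b x * Real.exp (-(m / n * magnetization x)))
    refine h.congr (ae_of_all _ fun g => ?_)
    simp only
    rw [mul_assoc, ← Real.exp_add]
    congr 2
    ring
  simp_rw [hlin, ← integral_const_mul]
  rw [← integral_finsetSum _ fun x _ => hint x, gaussianSqMGF, ← integral_mul_const]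
  refine integral_mono (integrable_finsetSum _ fun x _ => hint x)
    ((integrable_exp_mul_sq_gaussianReal hθ1).mul_const _) fun g => ?_
  -- For `z = √(θ/n) g - m/n` the terms linear in `g` cancel in `n z²/2 + z m`, leaving `θ g²/2 -
  -- m²/(2n)`.
  refine (sum_productMass_mul_exp_le hb _).trans_eq ?_
  rw [← Real.exp_add, hm]
  congr 1
  have : √(θ / n) ^ 2 * n = θ := by rw [hsq]; field_simp
  generalize √(θ / n) = r at this
  rw [← this]
  field_simp
  ring

/-- Removes the linear tilt: the spare quadratic term `(κ - θ) y² / (2n)` absorbs it by completing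
the square. -/
lemma sum_productMass_mul_exp_sq_le_of_lt {n : ℕ} (hn : 0 < n) {θ κ : ℝ} (hθ0 : 0 ≤ θ)
    (hθκ : θ < κ) (hκ1 : κ < 1) {b : Fin n → ℝ} (hb : ∀ i, |b i| ≤ 1) {m : ℝ}
    (hm : ∑ i, b i = m) :
    ∑ x, productMass b x * Real.exp (θ * magnetization x ^ 2 / (2 * n))
      ≤ gaussianSqMGF κ * Real.exp (m ^ 2 / n / (2 * (κ - θ))) := by
  have hn' : (0 : ℝ) < n := by exact_mod_cast hn
  have hd : 0 < κ - θ := by linarith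
  have hG := gaussianSqMGF_pos hκ1
  have h := sum_productMass_mul_exp_sq_le hn (hθ0.trans hθκ.le) hκ1 hb hm
  have key : ∀ y : ℝ, θ * y ^ 2 / (2 * n)
      ≤ m ^ 2 / n / (2 * (κ - θ)) + (κ * y ^ 2 / (2 * n) - m / n * y) := by
    intro y
    have : m ^ 2 / n / (2 * (κ - θ)) + (κ * y ^ 2 / (2 * n) - m / n * y) - θ * y ^ 2 / (2 * n)
        = ((κ - θ) * y - m) ^ 2 / (2 * n * (κ - θ)) := by
      field_simp
      ring
    have h2 : 0 ≤ ((κ - θ) * y - m) ^ 2 / (2 * n * (κ - θ)) := by positivity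
    linarith
  calc _ ≤ ∑ x, Real.exp (m ^ 2 / n / (2 * (κ - θ))) * (productMass b x *
        Real.exp (κ * magnetization x ^ 2 / (2 * n) - m / n * magnetization x)) := by
        refine Finset.sum_le_sum fun x _ => ?_
        rw [mul_left_comm, ← Real.exp_add]
        exact mul_le_mul_of_nonneg_left (Real.exp_le_exp.2 (key _)) (productMass_nonneg hb x)
    _ ≤ Real.exp (m ^ 2 / n / (2 * (κ - θ))) * gaussianSqMGF κ := by
        rw [← Finset.mul_sum]
        refine mul_le_mul_of_nonneg_left (h.trans ?_) (Real.exp_pos _).le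
        refine mul_le_of_le_one_right hG.le (Real.exp_le_one_iff.2 ?_)
        rw [Left.neg_nonpos_iff]
        positivity
    _ = _ := mul_comm _ _

/-! ### The model as a reweighted product law -/

/-- The Curie–Weiss density with means `b`, up to normalisation. -/
noncomputable def tiltedMass (θ : ℝ) {n : ℕ} (b : Fin n → ℝ) (x : Config n) : ℝ :=
  productMass b x * Real.exp (θ * magnetization x ^ 2 / (2 * n))

lemma tiltedMass_nonneg (θ : ℝ) {n : ℕ} {b : Fin n → ℝ} (hb : ∀ i, |b i| ≤ 1) (x : Config n) :
    0 ≤ tiltedMass θ b x :=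
  mul_nonneg (productMass_nonneg hb x) (Real.exp_pos _).le

/-- For `θ ≥ 0` the reweighting factor is at least 1. Normalisers can therefore be dropped in upper
bounds on probabilities. -/
lemma one_le_sum_tiltedMass {θ : ℝ} (hθ : 0 ≤ θ) {n : ℕ} {b : Fin n → ℝ}
    (hb : ∀ i, |b i| ≤ 1) : 1 ≤ ∑ x, tiltedMass θ b x := by
  rw [← sum_productMass b]
  refine Finset.sum_le_sum fun x _ => ?_
  refine le_mul_of_one_le_right (productMass_nonneg hb x) (Real.one_le_exp ?_)
  positivity

lemma magnetization_sq {n : ℕ} (x : Config n) :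
    magnetization x ^ 2 = n + 2 * ∑ i, ∑ j ∈ Finset.Ioi i, spin (x i) * spin (x j) := by
  have hsplit : ∀ i : Fin n, ∑ j, spin (x i) * spin (x j)
      = 1 + ∑ j ∈ Finset.Ioi i, spin (x i) * spin (x j)
        + ∑ j ∈ Finset.Iio i, spin (x i) * spin (x j) := by
    intro i
    have hu : (Finset.univ : Finset (Fin n)) = insert i (Finset.Ioi i ∪ Finset.Iio i) := by
      ext j
      simp only [Finset.mem_univ, Finset.mem_insert, Finset.mem_union, Finset.mem_Ioi,
        Finset.mem_Iio, true_iff]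
      rcases lt_trichotomy i j with h | h | h
      · exact Or.inr (Or.inl h)
      · exact Or.inl h.symm
      · exact Or.inr (Or.inr h)
    rw [hu, Finset.sum_insert (by simp), Finset.sum_union, spin_mul_self, add_assoc]
    rw [Finset.disjoint_left]
    intro j h1 h2
    exact lt_asymm (Finset.mem_Ioi.1 h1) (Finset.mem_Iio.1 h2)
  have hsymm : ∑ i : Fin n, ∑ j ∈ Finset.Iio i, spin (x i) * spin (x j)
      = ∑ i : Fin n, ∑ j ∈ Finset.Ioi i, spin (x i) * spin (x j) := by
    rw [Finset.sum_comm' (t' := Finset.univ) (s' := fun j => Finset.Ioi j) (by simp)]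
    exact Finset.sum_congr rfl fun i _ => Finset.sum_congr rfl fun j _ => mul_comm _ _
  rw [magnetization, sq, Finset.sum_mul_sum, Finset.sum_congr rfl fun i _ => hsplit i,
    Finset.sum_add_distrib, Finset.sum_add_distrib, hsymm]
  simp
  ring

/-- For a spin `e`, `exp (u e) = cosh u (1 + e tanh u)`; the diagonal terms of `M²` account for the
constant `θ / 2`. -/
lemma weight_eq_tiltedMass (θ : ℝ) {n : ℕ} (hn : 0 < n) (μ : Fin n → ℝ) (x : Config n) :
    weight θ μ x = Real.exp (-(θ / 2)) * (∏ i, 2 * Real.cosh (μ i))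
      * tiltedMass θ (fun i => Real.tanh (μ i)) x := by
  have hn' : (n : ℝ) ≠ 0 := by exact_mod_cast hn.ne'
  have hx : ∀ i, Real.exp (μ i * spin (x i))
      = 2 * Real.cosh (μ i) * ((1 + Real.tanh (μ i) * spin (x i)) / 2) := by
    intro i
    have hc := (Real.cosh_pos (μ i)).ne'
    rw [Real.tanh_eq_sinh_div_cosh]
    rcases spin_cases (x i) with h | h <;> rw [h]
    · rw [mul_one, ← Real.cosh_add_sinh]; field_simp
    · rw [mul_neg_one, ← Real.cosh_sub_sinh]; field_simp; ring
  have hquad : θ / n * ∑ i : Fin n, ∑ j ∈ Finset.Ioi i, spin (x i) * spin (x j)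
      = -(θ / 2) + θ * magnetization x ^ 2 / (2 * n) := by
    rw [magnetization_sq]
    field_simp
    ring
  rw [weight, hquad, Real.exp_add, Real.exp_add, Real.exp_sum, Finset.prod_congr rfl fun i _ => hx i,
    Finset.prod_mul_distrib, tiltedMass, productMass]
  ring

lemma abs_tanh_le_one (u : ℝ) : |Real.tanh u| ≤ 1 :=
  abs_le.2 ⟨(Real.neg_one_lt_tanh u).le, (Real.tanh_lt_one u).le⟩

open Classical in
lemma prob_eq_tiltedMass (θ : ℝ) {n : ℕ} (hn : 0 < n) (μ : Fin n → ℝ) (A : Set (Config n)) :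
    prob θ μ A = (∑ x with x ∈ A, tiltedMass θ (fun i => Real.tanh (μ i)) x)
      / ∑ x, tiltedMass θ (fun i => Real.tanh (μ i)) x := by
  have hC : Real.exp (-(θ / 2)) * (∏ i, 2 * Real.cosh (μ i)) ≠ 0 := by
    refine mul_ne_zero (Real.exp_pos _).ne' (Finset.prod_ne_zero_iff.2 fun i _ => ?_)
    exact mul_ne_zero two_ne_zero (Real.cosh_pos _).ne'
  rw [prob, partitionFn, ← Finset.sum_div]
  simp_rw [weight_eq_tiltedMass θ hn, ← Finset.mul_sum]
  rw [mul_div_mul_left _ _ hC]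

lemma partitionFn_pos (θ : ℝ) {n : ℕ} (μ : Fin n → ℝ) : 0 < partitionFn θ μ :=
  Finset.sum_pos (fun _ _ => Real.exp_pos _) Finset.univ_nonempty

lemma prob_nonneg (θ : ℝ) {n : ℕ} (μ : Fin n → ℝ) (A : Set (Config n)) : 0 ≤ prob θ μ A :=
  Finset.sum_nonneg fun _ _ => div_nonneg (Real.exp_pos _).le (partitionFn_pos θ μ).le

lemma prob_accept_add_prob_reject (θ : ℝ) {n : ℕ} (μ : Fin n → ℝ) (T : Test n) :
    prob θ μ {x | T x = 0} + prob θ μ {x | T x = 1} = 1 := by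
  have h : ∀ x, T x = 1 ↔ ¬ T x = 0 := fun x => by have := T x; omega
  simp only [prob, Set.mem_ofPred_eq, h]
  rw [Finset.sum_filter_add_sum_filter_not, ← Finset.sum_div]
  exact div_self (partitionFn_pos θ μ).ne'

lemma prob_accept_le_one (θ : ℝ) {n : ℕ} (μ : Fin n → ℝ) (T : Test n) :
    prob θ μ {x | T x = 0} ≤ 1 := by
  linarith [prob_accept_add_prob_reject θ μ T, prob_nonneg θ μ {x | T x = 1}]

lemma prob_reject_le_one (θ : ℝ) {n : ℕ} (μ : Fin n → ℝ) (T : Test n) :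
    prob θ μ {x | T x = 1} ≤ 1 := by
  linarith [prob_accept_add_prob_reject θ μ T, prob_nonneg θ μ {x | T x = 0}]

lemma risk_nonneg (θ : ℝ) {n : ℕ} (T : Test n) (s : ℕ) (B : ℝ) : 0 ≤ risk θ T s B :=
  add_nonneg (prob_nonneg _ _ _) (Real.iSup_nonneg fun _ => prob_nonneg _ _ _)

lemma risk_le_two (θ : ℝ) {n : ℕ} (T : Test n) (s : ℕ) (B : ℝ) : risk θ T s B ≤ 2 := by
  have h : (⨆ μ : alternatives n s B, prob θ (μ : Fin n → ℝ) {x | T x = 0}) ≤ 1 :=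
    Real.iSup_le (fun _ => prob_accept_le_one _ _ _) zero_le_one
  have := prob_reject_le_one θ (0 : Fin n → ℝ) T
  rw [risk]
  linarith

/-! ### Power of the naive test -/

lemma naiveTest_eq_one_iff {n : ℕ} (L : ℝ) (x : Config n) :
    naiveTest n L x = 1 ↔ L ≤ magnetization x / √(n : ℝ) := by
  have h : √(n : ℝ) * sampleMean x = magnetization x / √(n : ℝ) := by
    rw [sampleMean, magnetization, mul_div_assoc', mul_comm, mul_div_assoc,
      Real.sqrt_div_self', mul_one_div]
  rw [naiveTest, h]
  split_ifs with hL <;> simp [hL]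

lemma naiveTest_eq_zero_iff {n : ℕ} (L : ℝ) (x : Config n) :
    naiveTest n L x = 0 ↔ magnetization x / √(n : ℝ) < L := by
  rw [← not_le, ← naiveTest_eq_one_iff]
  omega

lemma prob_le_sum_tiltedMass {θ : ℝ} (hθ : 0 ≤ θ) {n : ℕ} (hn : 0 < n) (μ : Fin n → ℝ)
    (A : Set (Config n)) (f : Config n → ℝ) (hf : ∀ x, 0 ≤ f x)
    (hA : ∀ x ∈ A, tiltedMass θ (fun i => Real.tanh (μ i)) x ≤ f x) :
    prob θ μ A ≤ ∑ x, f x := by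
  classical
  rw [prob_eq_tiltedMass θ hn]
  have hb : ∀ i, |Real.tanh (μ i)| ≤ 1 := fun i => abs_tanh_le_one _
  calc _ ≤ ∑ x with x ∈ A, tiltedMass θ (fun i => Real.tanh (μ i)) x := by
        refine div_le_self ?_ (one_le_sum_tiltedMass hθ hb)
        exact Finset.sum_nonneg fun x _ => tiltedMass_nonneg θ hb x
    _ ≤ ∑ x with x ∈ A, f x :=
        Finset.sum_le_sum fun x hx => hA x (Finset.mem_filter.1 hx).2
    _ ≤ ∑ x, f x :=
        Finset.sum_le_sum_of_subset_of_nonneg (Finset.filter_subset _ _) fun x _ _ => hf x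

/-- Markov's inequality for the quadratic moment: raising `θ` to `κ` gains `(κ - θ) L² / 2` on the
rejection event. -/
lemma prob_naiveTest_reject_le {θ κ : ℝ} (hθ0 : 0 ≤ θ) (hθκ : θ < κ) (hκ1 : κ < 1) {n : ℕ}
    (hn : 0 < n) {L : ℝ} (hL : 0 ≤ L) :
    prob θ (0 : Fin n → ℝ) {x | naiveTest n L x = 1}
      ≤ gaussianSqMGF κ * Real.exp (-((κ - θ) / 2 * L ^ 2)) := by
  have hn' : (0 : ℝ) < n := by exact_mod_cast hn
  have hb : ∀ i : Fin n, |Real.tanh ((0 : Fin n → ℝ) i)| ≤ 1 := fun i => abs_tanh_le_one _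
  have h := sum_productMass_mul_exp_sq_le hn (hθ0.trans hθκ.le) hκ1 hb (m := 0) (by simp)
  refine (prob_le_sum_tiltedMass hθ0 hn _ _ (fun x =>
    productMass (fun i => Real.tanh ((0 : Fin n → ℝ) i)) x *
        Real.exp (κ * magnetization x ^ 2 / (2 * n) - 0 / n * magnetization x)
      * Real.exp (-((κ - θ) / 2 * L ^ 2)))
    (fun x => mul_nonneg (mul_nonneg (productMass_nonneg hb x) (Real.exp_pos _).le)
      (Real.exp_pos _).le) ?_).trans ?_
  · intro x hx
    have hx' : L ≤ magnetization x / √(n : ℝ) := (naiveTest_eq_one_iff L x).1 hx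
    have hsq : L ^ 2 ≤ magnetization x ^ 2 / n := by
      have := pow_le_pow_left₀ hL hx' 2
      rwa [div_pow, Real.sq_sqrt hn'.le] at this
    rw [tiltedMass, mul_assoc, ← Real.exp_add]
    refine mul_le_mul_of_nonneg_left (Real.exp_le_exp.2 ?_) (productMass_nonneg hb x)
    have h2 := mul_le_mul_of_nonneg_left hsq (show 0 ≤ (κ - θ) / 2 by linarith)
    have h3 : κ * magnetization x ^ 2 / (2 * n) - 0 / n * magnetization x
        = θ * magnetization x ^ 2 / (2 * n) + (κ - θ) / 2 * (magnetization x ^ 2 / n) := by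
      field_simp
      ring
    linarith
  · rw [← Finset.sum_mul]
    refine mul_le_mul_of_nonneg_right (h.trans_eq ?_) (Real.exp_pos _).le
    simp

lemma tanh_monotone : Monotone Real.tanh := by
  intro a b hab
  rw [Real.tanh_eq_sinh_div_cosh, Real.tanh_eq_sinh_div_cosh,
    div_le_div_iff₀ (Real.cosh_pos a) (Real.cosh_pos b)]
  have h := Real.sinh_nonneg_iff.2 (sub_nonneg.2 hab)
  rw [Real.sinh_sub] at h
  linarith

lemma tanh_nonneg {u : ℝ} (hu : 0 ≤ u) : 0 ≤ Real.tanh u :=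
  Real.tanh_zero ▸ tanh_monotone hu

lemma mul_tanh_le_sum_tanh {n s : ℕ} {B : ℝ} {μ : Fin n → ℝ} (hμ : μ ∈ alternatives n s B) :
    s * Real.tanh B ≤ ∑ i, Real.tanh (μ i) := by
  classical
  obtain ⟨hs, hB⟩ := hμ
  rw [← hs, Set.ncard_eq_toFinset_card', ← nsmul_eq_mul]
  calc _ ≤ ∑ i ∈ (Function.support μ).toFinset, Real.tanh (μ i) :=
        Finset.card_nsmul_le_sum _ _ _ fun i hi =>
          tanh_monotone (hB i (Set.mem_toFinset.1 hi))
    _ = _ := by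
        refine Finset.sum_subset (Finset.subset_univ _) fun i _ hi => ?_
        rw [Set.mem_toFinset, Function.notMem_support] at hi
        rw [hi, Real.tanh_zero]

/-- Chernoff bound with tilt `-m/n`, which costs `exp (d L)` on acceptance and gains `exp (-d²/2)`,
where `d = m / √n`. -/
lemma prob_naiveTest_accept_le {θ : ℝ} (hθ0 : 0 ≤ θ) (hθ1 : θ < 1) {n : ℕ}
    (hn : 0 < n) {L : ℝ} (hL : 0 ≤ L) {s : ℕ} {B : ℝ} {μ : Fin n → ℝ}
    (hμ : μ ∈ alternatives n s B) (hLB : 4 * L ≤ (√(n : ℝ))⁻¹ * (s * Real.tanh B)) :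
    prob θ μ {x | naiveTest n L x = 0} ≤ gaussianSqMGF θ * Real.exp (-(4 * L ^ 2)) := by
  have hn' : (0 : ℝ) < n := by exact_mod_cast hn
  have hr : 0 < √(n : ℝ) := Real.sqrt_pos.2 hn'
  have hrn : √(n : ℝ) ^ 2 = n := Real.sq_sqrt hn'.le
  have hb : ∀ i, |Real.tanh (μ i)| ≤ 1 := fun i => abs_tanh_le_one _
  obtain ⟨m, hm⟩ : ∃ m, ∑ i, Real.tanh (μ i) = m := ⟨_, rfl⟩
  obtain ⟨d, hd⟩ : ∃ d, m / √(n : ℝ) = d := ⟨_, rfl⟩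
  have hmd : m = d * √(n : ℝ) := by rw [← hd]; field_simp
  have hdL : 4 * L ≤ d := by
    refine hLB.trans ?_
    rw [← hd, div_eq_inv_mul, ← hm]
    exact mul_le_mul_of_nonneg_left (mul_tanh_le_sum_tanh hμ) (inv_pos.2 hr).le
  have h := sum_productMass_mul_exp_sq_le hn hθ0 hθ1 hb hm
  have hmn : m / n = d / √(n : ℝ) := by
    rw [hmd]; nth_rewrite 2 [← hrn]; field_simp
  have hmn2 : m ^ 2 / (2 * n) = d ^ 2 / 2 := by
    rw [hmd, mul_pow, hrn]; field_simp
  refine (prob_le_sum_tiltedMass hθ0 hn _ _ (fun x =>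
    productMass (fun i => Real.tanh (μ i)) x *
        Real.exp (θ * magnetization x ^ 2 / (2 * n) - m / n * magnetization x)
      * Real.exp (d * L))
    (fun x => mul_nonneg (mul_nonneg (productMass_nonneg hb x) (Real.exp_pos _).le)
      (Real.exp_pos _).le) ?_).trans ?_
  · intro x hx
    have hx' : magnetization x / √(n : ℝ) < L := (naiveTest_eq_zero_iff L x).1 hx
    rw [tiltedMass, mul_assoc, ← Real.exp_add]
    refine mul_le_mul_of_nonneg_left (Real.exp_le_exp.2 ?_) (productMass_nonneg hb x)
    have h2 := mul_le_mul_of_nonneg_left hx'.le (show 0 ≤ d by linarith)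
    rw [hmn, div_mul_eq_mul_div, mul_div_assoc d]
    linarith
  · rw [← Finset.sum_mul]
    refine (mul_le_mul_of_nonneg_right h (Real.exp_pos _).le).trans ?_
    rw [mul_assoc, ← Real.exp_add, hmn2]
    refine mul_le_mul_of_nonneg_left (Real.exp_le_exp.2 ?_) (gaussianSqMGF_pos hθ1).le
    -- Since `d ≥ 4L ≥ 0`, `d (d/2 - L) ≥ 4L²`.
    nlinarith

theorem naiveTest_asymptoticallyPowerful {θ : ℝ} (hθ0 : 0 ≤ θ) (hθ1 : θ < 1)
    {s : ℕ → ℕ} {B : ℕ → ℝ} (hB : ∀ n, 0 < B n) {L : ℕ → ℝ} (hL : Tendsto L atTop atTop)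
    (hLo : L =o[atTop] (fun n : ℕ => (√(n : ℝ))⁻¹ * ((s n : ℝ) * Real.tanh (B n)))) :
    AsymptoticallyPowerful θ s B (fun n => naiveTest n (L n)) := by
  have hsq : Tendsto (fun n => L n ^ 2) atTop atTop := (tendsto_pow_atTop two_ne_zero).comp hL
  have hexp : ∀ K c : ℝ, 0 < c →
      Tendsto (fun n => K * Real.exp (-(c * L n ^ 2))) atTop (nhds 0) := by
    intro K c hc
    rw [← mul_zero K]
    exact (Real.tendsto_exp_neg_atTop_nhds_zero.comp (hsq.const_mul_atTop hc)).const_mul K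
  have hlim := (hexp (gaussianSqMGF ((1 + θ) / 2)) (((1 + θ) / 2 - θ) / 2) (by linarith)).add
    (hexp (gaussianSqMGF θ) 4 (by norm_num))
  rw [add_zero] at hlim
  refine Tendsto.limsup_eq (tendsto_of_tendsto_of_tendsto_of_le_of_le' tendsto_const_nhds hlim
    (Eventually.of_forall fun n => risk_nonneg _ _ _ _) ?_)
  filter_upwards [eventually_gt_atTop 0, hL.eventually_ge_atTop 0,
    hLo.def (c := 1 / 4) (by norm_num)] with n hn hLn hn2
  have hpos : 0 ≤ (√(n : ℝ))⁻¹ * ((s n : ℝ) * Real.tanh (B n)) := by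
    have := tanh_nonneg (hB n).le
    positivity
  rw [Real.norm_of_nonneg hLn, Real.norm_of_nonneg hpos] at hn2
  refine add_le_add (prob_naiveTest_reject_le hθ0 (by linarith) (by linarith) hn hLn)
    (Real.iSup_le (fun μ => prob_naiveTest_accept_le hθ0 hθ1 hn hLn μ.2 (by linarith)) ?_)
  -- The bound must be nonnegative because a real supremum over an empty family is 0.
  exact mul_nonneg (gaussianSqMGF_pos hθ1).le (Real.exp_pos _).le

/-! ### Second moments and overlaps -/

/-- The product of two product masses relative to the uniform mass. -/
noncomputable def overlapMass {n : ℕ} (b b' : Fin n → ℝ) (x : Config n) : ℝ :=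
  ∏ i, (1 + b i * spin (x i)) * (1 + b' i * spin (x i)) / 2

lemma productMass_mul_productMass {n : ℕ} (b b' : Fin n → ℝ) (x : Config n) :
    productMass b x * productMass b' x = (1 / 2) ^ n * overlapMass b b' x := by
  have h : ((1 : ℝ) / 2) ^ n = ∏ _i : Fin n, (1 : ℝ) / 2 := by simp
  rw [productMass, productMass, overlapMass, h, ← Finset.prod_mul_distrib,
    ← Finset.prod_mul_distrib]
  exact Finset.prod_congr rfl fun i _ => by ring

lemma overlapMass_nonneg {n : ℕ} {b b' : Fin n → ℝ} (hb : ∀ i, |b i| ≤ 1) (hb' : ∀ i, |b' i| ≤ 1)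
    (x : Config n) : 0 ≤ overlapMass b b' x := by
  refine Finset.prod_nonneg fun i _ => ?_
  obtain ⟨h1, h2⟩ := abs_le.1 (hb i)
  obtain ⟨h3, h4⟩ := abs_le.1 (hb' i)
  refine div_nonneg (mul_nonneg ?_ ?_) zero_le_two
  all_goals rcases spin_cases (x i) with h | h <;> rw [h] <;> linarith

/-- Since spins square to 1, means combine by the addition formula for `tanh`. An overlap is again a
product law, so the moment bounds apply to it. -/
lemma overlapMass_eq {n : ℕ} {b b' : Fin n → ℝ} (hb : ∀ i, 0 ≤ b i) (hb' : ∀ i, 0 ≤ b' i)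
    (x : Config n) : overlapMass b b' x = (∏ i, (1 + b i * b' i))
      * productMass (fun i => (b i + b' i) / (1 + b i * b' i)) x := by
  rw [overlapMass, productMass, ← Finset.prod_mul_distrib]
  refine Finset.prod_congr rfl fun i _ => ?_
  have h : 1 + b i * b' i ≠ 0 := by
    have := mul_nonneg (hb i) (hb' i)
    positivity
  have hs : spin (x i) ^ 2 = 1 := by rw [sq, spin_mul_self]
  field_simp
  linear_combination (b i * b' i) * hs

lemma sum_overlapMass_mul_exp_sq_le {n : ℕ} (hn : 0 < n) {θ κ : ℝ} (hθ0 : 0 ≤ θ) (hθκ : θ < κ)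
    (hκ1 : κ < 1) {b b' : Fin n → ℝ} (hb : ∀ i, 0 ≤ b i) (hb1 : ∀ i, b i ≤ 1)
    (hb' : ∀ i, 0 ≤ b' i) (hb1' : ∀ i, b' i ≤ 1) :
    ∑ x, overlapMass b b' x * Real.exp (θ * magnetization x ^ 2 / (2 * n))
      ≤ (∏ i, (1 + b i * b' i)) * (gaussianSqMGF κ *
        Real.exp ((∑ i, b i + ∑ i, b' i) ^ 2 / n / (2 * (κ - θ)))) := by
  have hpos : ∀ i, 0 ≤ b i * b' i := fun i => mul_nonneg (hb i) (hb' i)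
  have hc0 : ∀ i, 0 ≤ (b i + b' i) / (1 + b i * b' i) := fun i =>
    div_nonneg (add_nonneg (hb i) (hb' i)) (by linarith [hpos i])
  have hc : ∀ i, |(b i + b' i) / (1 + b i * b' i)| ≤ 1 := by
    intro i
    rw [abs_of_nonneg (hc0 i), div_le_one (by linarith [hpos i])]
    nlinarith [hb1 i, hb1' i]
  have h := sum_productMass_mul_exp_sq_le_of_lt hn hθ0 hθκ hκ1 hc rfl
  simp_rw [overlapMass_eq hb hb', mul_assoc]
  rw [← Finset.mul_sum]
  refine mul_le_mul_of_nonneg_left (h.trans ?_)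
    (Finset.prod_nonneg fun i _ => by linarith [hpos i])
  refine mul_le_mul_of_nonneg_left (Real.exp_le_exp.2 ?_) (gaussianSqMGF_pos hκ1).le
  have hd : 0 < κ - θ := by linarith
  have hsum : ∑ i, (b i + b' i) / (1 + b i * b' i) ≤ ∑ i, b i + ∑ i, b' i := by
    rw [← Finset.sum_add_distrib]
    exact Finset.sum_le_sum fun i _ =>
      div_le_self (add_nonneg (hb i) (hb' i)) (by linarith [hpos i])
  have h0 : 0 ≤ ∑ i, (b i + b' i) / (1 + b i * b' i) := Finset.sum_nonneg fun i _ => hc0 i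
  gcongr

/-- The second moment bound for a uniform mixture of alternatives. -/
lemma sq_card_mul_one_sub_le {θ : ℝ} (hθ0 : 0 ≤ θ) {n : ℕ} (hn : 0 < n) {ι : Type*} [Fintype ι]
    (μ : ι → Fin n → ℝ) (T : Test n) {σ : ℝ} (hσ1 : σ ≤ 1)
    (hσ : ∀ f, prob θ (μ f) {x | T x = 0} ≤ σ) :
    (Fintype.card ι * (1 - σ)) ^ 2 ≤ prob θ (0 : Fin n → ℝ) {x | T x = 1}
      * (∑ x, tiltedMass θ (0 : Fin n → ℝ) x)
      * ∑ f, ∑ g, ∑ x, overlapMass (fun i => Real.tanh (μ f i)) (fun i => Real.tanh (μ g i)) x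
          * Real.exp (θ * magnetization x ^ 2 / (2 * n)) := by
  classical
  have hb : ∀ f i, |Real.tanh (μ f i)| ≤ 1 := fun f i => abs_tanh_le_one _
  have hzero : (fun i => Real.tanh ((0 : Fin n → ℝ) i)) = 0 := by
    ext i; simp
  have hN : 1 ≤ ∑ x, tiltedMass θ (0 : Fin n → ℝ) x := one_le_sum_tiltedMass hθ0 (by simp)
  set R : Finset (Config n) := @Finset.filter _ (fun x => x ∈ {x | T x = 1})
    (fun _ => Classical.propDecidable _) Finset.univ
  have h0 : prob θ (0 : Fin n → ℝ) {x | T x = 1} * (∑ x, tiltedMass θ (0 : Fin n → ℝ) x)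
      = ∑ x ∈ R, tiltedMass θ (0 : Fin n → ℝ) x := by
    rw [prob_eq_tiltedMass θ hn, hzero, div_mul_cancel₀ _ (by linarith)]
  have hlow : ∀ f, 1 - σ ≤ ∑ x ∈ R, tiltedMass θ (fun i => Real.tanh (μ f i)) x := by
    intro f
    have h1 := prob_accept_add_prob_reject θ (μ f) T
    have h2 : prob θ (μ f) {x | T x = 1} ≤ ∑ x ∈ R, tiltedMass θ (fun i => Real.tanh (μ f i)) x := by
      rw [prob_eq_tiltedMass θ hn]
      exact div_le_self (Finset.sum_nonneg fun x _ => tiltedMass_nonneg θ (hb f) x)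
        (one_le_sum_tiltedMass hθ0 (hb f))
    linarith [hσ f]
  have hcard : Fintype.card ι * (1 - σ)
      ≤ ∑ x ∈ R, ∑ f, tiltedMass θ (fun i => Real.tanh (μ f i)) x := by
    rw [Finset.sum_comm, ← nsmul_eq_mul]
    exact Finset.card_nsmul_le_sum _ _ _ fun f _ => hlow f
  have hterm : ∀ x f g, 0 ≤ overlapMass (fun i => Real.tanh (μ f i))
      (fun i => Real.tanh (μ g i)) x * Real.exp (θ * magnetization x ^ 2 / (2 * n)) :=
    fun x f g => mul_nonneg (overlapMass_nonneg (hb f) (hb g) x) (Real.exp_pos _).le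
  calc (Fintype.card ι * (1 - σ)) ^ 2
      ≤ (∑ x ∈ R, ∑ f, tiltedMass θ (fun i => Real.tanh (μ f i)) x) ^ 2 :=
        pow_le_pow_left₀ (mul_nonneg (Nat.cast_nonneg _) (by linarith)) hcard 2
    -- Cauchy–Schwarz relative to the null density, whose product part is exactly `2⁻ⁿ`.
    _ ≤ (∑ x ∈ R, tiltedMass θ (0 : Fin n → ℝ) x) * ∑ x ∈ R, ∑ f, ∑ g,
          overlapMass (fun i => Real.tanh (μ f i)) (fun i => Real.tanh (μ g i)) x
            * Real.exp (θ * magnetization x ^ 2 / (2 * n)) := by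
        refine Finset.sum_sq_le_sum_mul_sum_of_sq_le_mul _
          (fun x _ => tiltedMass_nonneg θ (by simp) x)
          (fun x _ => Finset.sum_nonneg fun f _ => Finset.sum_nonneg fun g _ => hterm x f g)
          fun x _ => le_of_eq ?_
        have hw : productMass (0 : Fin n → ℝ) x = (1 / 2) ^ n := by simp [productMass]
        rw [sq, Finset.sum_mul_sum, Finset.mul_sum]
        refine Finset.sum_congr rfl fun f _ => ?_
        rw [Finset.mul_sum]
        refine Finset.sum_congr rfl fun g _ => ?_
        rw [tiltedMass, tiltedMass, tiltedMass, hw, mul_mul_mul_comm,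
          productMass_mul_productMass]
        ring
    _ ≤ (∑ x ∈ R, tiltedMass θ (0 : Fin n → ℝ) x) * ∑ x, ∑ f, ∑ g,
          overlapMass (fun i => Real.tanh (μ f i)) (fun i => Real.tanh (μ g i)) x
            * Real.exp (θ * magnetization x ^ 2 / (2 * n)) := by
        refine mul_le_mul_of_nonneg_left (Finset.sum_le_sum_of_subset_of_nonneg
          (Finset.subset_univ _) fun x _ _ => Finset.sum_nonneg fun f _ =>
            Finset.sum_nonneg fun g _ => hterm x f g)
          (Finset.sum_nonneg fun x _ => tiltedMass_nonneg θ (by simp) x)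
    _ = _ := by
        rw [h0, Finset.sum_comm]
        congr 1
        exact Finset.sum_congr rfl fun f _ => Finset.sum_comm

/-! ### The block prior -/

section BlockPrior

variable {n s m : ℕ}

/-- The signal of strength `B` with one active coordinate `φ (a, f a)` in each block `a`. -/
noncomputable def blockSignal (φ : Fin s × Fin m ↪ Fin n) (B : ℝ) (f : Fin s → Fin m)
    (i : Fin n) : ℝ :=
  if i ∈ Finset.univ.image (fun a => φ (a, f a)) then B else 0

lemma injective_blockEmbedding (φ : Fin s × Fin m ↪ Fin n) (f : Fin s → Fin m) :
    Function.Injective (fun a => φ (a, f a)) := fun _ _ h =>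
  (Prod.ext_iff.1 (φ.injective h)).1

lemma blockSignal_apply (φ : Fin s × Fin m ↪ Fin n) (B : ℝ) (f : Fin s → Fin m) (a : Fin s)
    (j : Fin m) : blockSignal φ B f (φ (a, j)) = if j = f a then B else 0 := by
  rw [blockSignal]
  congr 1
  simp only [Finset.mem_image, Finset.mem_univ, true_and, EmbeddingLike.apply_eq_iff_eq,
    Prod.mk.injEq, eq_iff_iff]
  constructor
  · rintro ⟨a', rfl, h⟩
    exact h.symm
  · rintro rfl
    exact ⟨a, rfl, rfl⟩

lemma tanh_blockSignal (φ : Fin s × Fin m ↪ Fin n) (B : ℝ) (f : Fin s → Fin m) (i : Fin n) :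
    Real.tanh (blockSignal φ B f i) = blockSignal φ (Real.tanh B) f i := by
  rw [blockSignal, blockSignal, apply_ite Real.tanh, Real.tanh_zero]

lemma blockSignal_mem_alternatives (φ : Fin s × Fin m ↪ Fin n) {B : ℝ} (hB : 0 < B)
    (f : Fin s → Fin m) : blockSignal φ B f ∈ alternatives n s B := by
  have hsupp : Function.support (blockSignal φ B f)
      = (Finset.univ.image (fun a => φ (a, f a)) : Finset (Fin n)) := by
    ext i
    rw [Function.mem_support, blockSignal, Finset.mem_coe]
    split_ifs with h <;> simp [h, hB.ne']
  refine ⟨?_, fun i hi => ?_⟩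
  · rw [hsupp, Set.ncard_coe_finset, Finset.card_image_of_injective _
      (injective_blockEmbedding φ f), Finset.card_univ, Fintype.card_fin]
  · rw [hsupp, Finset.mem_coe] at hi
    rw [blockSignal, if_pos hi]

lemma sum_blockSignal (φ : Fin s × Fin m ↪ Fin n) (t : ℝ) (f : Fin s → Fin m) :
    ∑ i, blockSignal φ t f i = s * t := by
  simp only [blockSignal]
  rw [Finset.sum_ite_mem, Finset.univ_inter, Finset.sum_const, Finset.card_image_of_injective _
    (injective_blockEmbedding φ f), Finset.card_univ, Fintype.card_fin, nsmul_eq_mul]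

lemma prod_one_add_blockSignal_mul (φ : Fin s × Fin m ↪ Fin n) (t : ℝ) (f g : Fin s → Fin m) :
    ∏ i, (1 + blockSignal φ t f i * blockSignal φ t g i)
      = ∏ a, (1 + if f a = g a then t ^ 2 else 0) := by
  rw [← Finset.prod_subset (Finset.subset_univ (Finset.univ.image (fun a => φ (a, f a)))),
    Finset.prod_image (injective_blockEmbedding φ f).injOn]
  · refine Finset.prod_congr rfl fun a _ => ?_
    rw [blockSignal_apply, blockSignal_apply, if_pos rfl]
    split_ifs <;> ring
  · intro i _ hi
    rw [blockSignal, if_neg hi, zero_mul, add_zero]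

/-- The choices in different blocks are free, so the sum factorises; in each block exactly one of
the `m` choices agrees with `f`. -/
lemma sum_prod_one_add_blockSignal_mul (φ : Fin s × Fin m ↪ Fin n) (t : ℝ) (f : Fin s → Fin m) :
    ∑ g, ∏ i, (1 + blockSignal φ t f i * blockSignal φ t g i) = (m + t ^ 2) ^ s := by
  simp_rw [prod_one_add_blockSignal_mul]
  rw [← Fintype.prod_sum fun a j => (1 + if f a = j then t ^ 2 else 0)]
  simp [Finset.sum_add_distrib]

end BlockPrior

lemma add_sq_pow_le {n s : ℕ} (hs : s ≤ n) {t C : ℝ} (hC : (s * t) ^ 2 ≤ C ^ 2 * n) :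
    (((n / s : ℕ) : ℝ) + t ^ 2) ^ s ≤ ((n / s : ℕ) : ℝ) ^ s * Real.exp (2 * C ^ 2) := by
  rcases Nat.eq_zero_or_pos s with rfl | hs0
  -- Here `n / 0 = 0`, and both zeroth powers equal 1.
  · simpa using (by positivity : (0 : ℝ) ≤ C ^ 2)
  obtain ⟨m, hm⟩ : ∃ m, n / s = m := ⟨_, rfl⟩
  have hm1 : 1 ≤ m := hm ▸ (Nat.one_le_div_iff hs0).2 hs
  -- The remainder of `n` modulo `s` is below `s ≤ m s`; this is the source of the 2 in `2 * C ^ 2`.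
  have hnm : n ≤ 2 * m * s := by
    have h2 := Nat.div_add_mod n s
    have h3 := Nat.mod_lt n hs0
    rw [hm] at h2
    nlinarith
  have hnm' : (n : ℝ) ≤ 2 * m * s := by exact_mod_cast hnm
  have hm0 : (0 : ℝ) < m := by exact_mod_cast hm1
  have hs' : (0 : ℝ) < s := by exact_mod_cast hs0
  rw [hm]
  have hexp : s * (t ^ 2 / m) ≤ 2 * C ^ 2 := by
    rw [mul_div_assoc', div_le_iff₀ hm0]
    have h1 : (s * t) ^ 2 ≤ C ^ 2 * (2 * m * s) :=
      hC.trans (mul_le_mul_of_nonneg_left hnm' (sq_nonneg C))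
    refine le_of_mul_le_mul_left ?_ hs'
    linarith
  calc ((m : ℝ) + t ^ 2) ^ s = (m : ℝ) ^ s * (t ^ 2 / m + 1) ^ s := by
        rw [← mul_pow]
        congr 1
        field_simp
        ring
    _ ≤ (m : ℝ) ^ s * Real.exp (t ^ 2 / m) ^ s := by
        gcongr
        exact Real.add_one_le_exp _
    _ = (m : ℝ) ^ s * Real.exp (s * (t ^ 2 / m)) := by rw [← Real.exp_nat_mul]
    _ ≤ _ := by gcongr

/-! ### Lower bound on the risk of every test -/

lemma prob_accept_le_iSup (θ : ℝ) {n s : ℕ} {B : ℝ} (T : Test n) {μ : Fin n → ℝ}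
    (hμ : μ ∈ alternatives n s B) : prob θ μ {x | T x = 0}
      ≤ ⨆ μ : alternatives n s B, prob θ (μ : Fin n → ℝ) {x | T x = 0} :=
  le_ciSup (f := fun μ : alternatives n s B => prob θ (μ : Fin n → ℝ) {x | T x = 0})
    ⟨1, by rintro _ ⟨μ, rfl⟩; exact prob_accept_le_one _ _ _⟩ ⟨μ, hμ⟩

lemma one_sub_iSup_sq_le {θ κ : ℝ} (hθ0 : 0 ≤ θ) (hθκ : θ < κ) (hκ1 : κ < 1) {n s : ℕ}
    (hn : 0 < n) (hs : s ≤ n) {B C : ℝ} (hB : 0 < B) (hC : (s * Real.tanh B) ^ 2 ≤ C ^ 2 * n)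
    (T : Test n) :
    (1 - ⨆ μ : alternatives n s B, prob θ (μ : Fin n → ℝ) {x | T x = 0}) ^ 2
      ≤ gaussianSqMGF κ * (gaussianSqMGF κ * Real.exp (4 * C ^ 2 / (2 * (κ - θ))))
          * Real.exp (2 * C ^ 2) * prob θ (0 : Fin n → ℝ) {x | T x = 1} := by
  have hn' : (0 : ℝ) < n := by exact_mod_cast hn
  have hd : 0 < κ - θ := by linarith
  have hK := gaussianSqMGF_pos hκ1
  set σ := ⨆ μ : alternatives n s B, prob θ (μ : Fin n → ℝ) {x | T x = 0} with hσ
  set t := Real.tanh B with ht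
  have ht0 : 0 ≤ t := tanh_nonneg hB.le
  have ht1 : t ≤ 1 := (Real.tanh_lt_one B).le
  have hσ1 : σ ≤ 1 := Real.iSup_le (fun _ => prob_accept_le_one _ _ _) zero_le_one
  obtain ⟨φ⟩ : Nonempty (Fin s × Fin (n / s) ↪ Fin n) :=
    Function.Embedding.nonempty_of_card_le (by simpa using Nat.mul_div_le n s)
  have hcs := sq_card_mul_one_sub_le hθ0 hn (fun f => blockSignal φ B f) T hσ1
    fun f => prob_accept_le_iSup θ T (blockSignal_mem_alternatives φ hB f)
  simp_rw [tanh_blockSignal] at hcs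
  have hb0 : ∀ f i, 0 ≤ blockSignal φ t f i := by
    intro f i
    rw [blockSignal]
    split_ifs <;> simp [ht0]
  have hb1 : ∀ f i, blockSignal φ t f i ≤ 1 := by
    intro f i
    rw [blockSignal]
    split_ifs <;> simp [ht1]
  set E := gaussianSqMGF κ * Real.exp (4 * C ^ 2 / (2 * (κ - θ))) with hE
  have hE0 : 0 < E := by positivity
  have hpair : ∀ f g, ∑ x, overlapMass (fun i => blockSignal φ t f i)
        (fun i => blockSignal φ t g i) x * Real.exp (θ * magnetization x ^ 2 / (2 * n))
      ≤ (∏ i, (1 + blockSignal φ t f i * blockSignal φ t g i)) * E := by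
    intro f g
    refine (sum_overlapMass_mul_exp_sq_le hn hθ0 hθκ hκ1 (hb0 f) (hb1 f) (hb0 g) (hb1 g)).trans ?_
    refine mul_le_mul_of_nonneg_left ?_ (Finset.prod_nonneg fun i _ => by
      have := mul_nonneg (hb0 f i) (hb0 g i)
      linarith)
    refine mul_le_mul_of_nonneg_left (Real.exp_le_exp.2 ?_) hK.le
    -- The means of the two signals total `2 s t`, whence `4 * C ^ 2`, uniformly in the pair.
    rw [sum_blockSignal, sum_blockSignal]
    refine div_le_div_of_nonneg_right ?_ (by linarith)
    rw [div_le_iff₀ hn']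
    linarith
  have hcard : ((Fintype.card (Fin s → Fin (n / s)) : ℕ) : ℝ) = ((n / s : ℕ) : ℝ) ^ s := by simp
  set N : ℝ := ((n / s : ℕ) : ℝ) ^ s with hN
  have hN0 : 0 < N := by
    rcases Nat.eq_zero_or_pos s with h | h
    · rw [hN, h, pow_zero]; exact one_pos
    · have := Nat.div_pos hs h
      positivity
  have hsum : ∑ f, ∑ g, ∑ x, overlapMass (fun i => blockSignal φ t f i)
        (fun i => blockSignal φ t g i) x * Real.exp (θ * magnetization x ^ 2 / (2 * n))
      ≤ N * (N * Real.exp (2 * C ^ 2) * E) := by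
    calc _ ≤ ∑ f : Fin s → Fin (n / s), N * Real.exp (2 * C ^ 2) * E := by
          refine Finset.sum_le_sum fun f _ => ?_
          refine (Finset.sum_le_sum fun g _ => hpair f g).trans ?_
          rw [← Finset.sum_mul, sum_prod_one_add_blockSignal_mul]
          exact mul_le_mul_of_nonneg_right (add_sq_pow_le hs hC) hE0.le
      _ = _ := by rw [Finset.sum_const, Finset.card_univ, nsmul_eq_mul, hcard]
  have hnull : ∑ x, tiltedMass θ (0 : Fin n → ℝ) x ≤ gaussianSqMGF κ := by
    have h := sum_productMass_mul_exp_sq_le_of_lt hn hθ0 hθκ hκ1 (b := (0 : Fin n → ℝ)) (m := 0)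
      (by simp) (by simp)
    simpa [tiltedMass] using h
  have hP := prob_nonneg θ (0 : Fin n → ℝ) {x | T x = 1}
  rw [hcard] at hcs
  have hfin : (N * (1 - σ)) ^ 2 ≤ prob θ (0 : Fin n → ℝ) {x | T x = 1} * gaussianSqMGF κ
      * (N * (N * Real.exp (2 * C ^ 2) * E)) := by
    refine hcs.trans ((mul_le_mul_of_nonneg_left hsum ?_).trans ?_)
    · exact mul_nonneg hP (Finset.sum_nonneg fun x _ => tiltedMass_nonneg θ (by simp) x)
    · refine mul_le_mul_of_nonneg_right (mul_le_mul_of_nonneg_left hnull hP) ?_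
      positivity
  refine le_of_mul_le_mul_left ?_ (pow_pos hN0 2)
  rw [← mul_pow]
  refine hfin.trans_eq ?_
  ring

/-- A smaller sum would force `σ < 1/2`, hence `M ε > 1/4`, contradicting `ε (4M + 2) < 1`. -/
lemma inv_le_add_of_one_sub_sq_le {ε σ M : ℝ} (hM : 0 < M) (hε : 0 ≤ ε) (hσ : 0 ≤ σ)
    (h : (1 - σ) ^ 2 ≤ M * ε) : (4 * M + 2)⁻¹ ≤ ε + σ := by
  by_contra! hlt
  have hσ2 : σ < 1 / 2 := by
    have : (4 * M + 2)⁻¹ ≤ (2 : ℝ)⁻¹ := inv_anti₀ two_pos (by linarith)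
    linarith
  have hε2 : ε * (4 * M + 2) < 1 := by
    rw [← lt_div_iff₀ (by linarith), one_div]
    linarith
  nlinarith

theorem asymptoticallyNotPowerful_of_isBigO {θ : ℝ} (hθ0 : 0 ≤ θ) (hθ1 : θ < 1)
    {s : ℕ → ℕ} {B : ℕ → ℝ} (hs : ∀ n, s n ≤ n) (hB : ∀ n, 0 < B n)
    (hO : (fun n : ℕ => (s n : ℝ) * Real.tanh (B n)) =O[atTop] (fun n : ℕ => √(n : ℝ)))
    (T : ∀ n, Test n) : AsymptoticallyNotPowerful θ s B T := by
  obtain ⟨C, hC⟩ := hO.bound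
  obtain ⟨κ, hθκ, hκ1⟩ := exists_between hθ1
  have hK := gaussianSqMGF_pos hκ1
  set M := gaussianSqMGF κ * (gaussianSqMGF κ * Real.exp (4 * C ^ 2 / (2 * (κ - θ))))
    * Real.exp (2 * C ^ 2) with hM
  have hM0 : 0 < M := by positivity
  have hev : ∀ᶠ n in atTop, (4 * M + 2)⁻¹ ≤ risk θ (T n) (s n) (B n) := by
    filter_upwards [eventually_gt_atTop 0, hC] with n hn hCn
    have hCn' : ((s n : ℝ) * Real.tanh (B n)) ^ 2 ≤ C ^ 2 * n := by
      have := pow_le_pow_left₀ (norm_nonneg _) hCn 2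
      rwa [Real.norm_eq_abs, sq_abs, mul_pow C, Real.norm_eq_abs, sq_abs,
        Real.sq_sqrt (Nat.cast_nonneg n)] at this
    exact inv_le_add_of_one_sub_sq_le hM0 (prob_nonneg _ _ _)
      (Real.iSup_nonneg fun _ => prob_nonneg _ _ _)
      (one_sub_iSup_sq_le hθ0 hθκ hκ1 hn (hs n) (hB n) hCn' (T n))
  -- A real `liminf` is only meaningful for a cobounded sequence; the bound 2 on the risk supplies
  -- this.
  have hcob : IsCoboundedUnder (· ≥ ·) atTop fun n => risk θ (T n) (s n) (B n) :=
    IsBoundedUnder.isCoboundedUnder_ge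
      ⟨2, eventually_map.2 (Eventually.of_forall fun n => risk_le_two _ _ _ _)⟩
  exact (show (0 : ℝ) < (4 * M + 2)⁻¹ by positivity).trans_le (le_liminf_of_le hcob hev)

lemma AsymptoticallyNotPowerful.not_asymptoticallyPowerful {θ : ℝ} {s : ℕ → ℕ} {B : ℕ → ℝ}
    {T : ∀ n, Test n} (h : AsymptoticallyNotPowerful θ s B T) :
    ¬ AsymptoticallyPowerful θ s B T := by
  intro hp
  have hle := liminf_le_limsup (f := atTop) (u := fun n => risk θ (T n) (s n) (B n))
    ⟨2, eventually_map.2 (Eventually.of_forall fun n => risk_le_two _ _ _ _)⟩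
    ⟨0, eventually_map.2 (Eventually.of_forall fun n => risk_nonneg _ _ _ _)⟩
  exact (h.trans_le hle).ne' hp

end CurieWeiss

theorem theorem1 (θ : ℝ) (hθ0 : 0 ≤ θ) (hθ1 : θ < 1)
    (s : ℕ → ℕ) (B : ℕ → ℝ) (hs : ∀ n, s n ≤ n) (hB : ∀ n, 0 < B n) :
    ((fun n : ℕ => √(n : ℝ)) =o[atTop] (fun n : ℕ => (s n : ℝ) * Real.tanh (B n)) →
      ∀ L : ℕ → ℝ, Tendsto L atTop atTop →
        L =o[atTop] (fun n : ℕ => (√(n : ℝ))⁻¹ * ((s n : ℝ) * Real.tanh (B n))) →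
        CurieWeiss.AsymptoticallyPowerful θ s B
          (fun n => CurieWeiss.naiveTest n (L n))) ∧
    ((fun n : ℕ => (s n : ℝ) * Real.tanh (B n)) =O[atTop] (fun n : ℕ => √(n : ℝ)) →
      (¬ ∃ T : ∀ n, CurieWeiss.Test n, CurieWeiss.AsymptoticallyPowerful θ s B T) ∧
      ∀ T : ∀ n, CurieWeiss.Test n, CurieWeiss.AsymptoticallyNotPowerful θ s B T) := by
  refine ⟨fun _ L hL hLo => CurieWeiss.naiveTest_asymptoticallyPowerful hθ0 hθ1 hB hL hLo,
    fun hO => ?_⟩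
  have h := CurieWeiss.asymptoticallyNotPowerful_of_isBigO hθ0 hθ1 hs hB hO
  exact ⟨fun ⟨T, hT⟩ => (h T).not_asymptoticallyPowerful hT, h⟩
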